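/- **Setting.** Let $\mathbb X$ be a non-empty compact metric space, $\mathbb S=\mathcal C(\mathbb X)$ with the sup norm and its Borel $\sigma$-algebra $\mathcal S$, and $\tau:\mathbb X\to[0,\infty)$ continuous. Let $\mathbb M$ be the set of all (possibly degenerate) Gaussian measures on $\mathbb S$, with the $\sigma$-algebra generated by the maps $\nu\mapsto\nu(A)$, $A\in\mathcal S$. For $\nu\in\mathbb M$ let $m_\nu,k_\nu$ be its mean and covariance functions, write $\nu=\mathrm{GP}(m_\nu,k_\nu)$, and put $s_\nu^2(x)=k_\nu(x,x)+\tau^2(x)$. We write $\nu_n\to\nu_\infty$ if $m_{\nu_n}\to m_{\nu_\infty}$ and $k_{\nu_n}\to k_{\nu_\infty}$ uniformly. For $x\in\mathbb X$, $z\in\mathbb R$ let $$\mathrm{Cond}_{x,z}(\nu)=\mathrm{GP}\Big(m_\nu+k_\nu(\cdot,x)\,\tfrac{z-m_\nu(x)}{s_\nu^2(x)},\;\; k_\nu-\tfrac{k_\nu(\cdot,x)\,k_\nu(x,\cdot)}{s_\nu^2(x)}\Big)\quad\text{if } s^2_\nu(x)>0,$$ and $\mathrm{Cond}_{x,z}(\nu)=\nu$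 if $s_\nu^2(x)=0$. Let $\xi$ be a Gaussian random element of $\mathbb S$ with law $P_0^\xi=\nu_0\in\mathbb M$, and let $U_1,U_2,\dots$ be i.i.d. $\mathcal N(0,1)$, independent of $\xi$, on a probability space $(\Omega,\mathcal F,\mathbb P)$. For $\mathbb X$-valued $X_1,X_2,\dots$ put $Z_n=\xi(X_n)+\tau(X_n)U_n$ and $\mathcal F_n=\sigma(X_1,Z_1,\dots,X_n,Z_n)$. The sequence $(X_n)_{n\ge1}$ is a *sequential design* if $X_n$ is $\mathcal F_{n-1}$-measurable for all $n\ge1$. The conditional distribution of $\xi$ given $\mathcal F_n$ is represented by $P_{n}^\xi=\mathrm{Cond}_{X_{n},Z_{n}}(P_{n-1}^\xi)$, $n\ge1$; put $s_n^2=s^2_{P_n^\xi}$. For measurable $\mathcal H:\mathbb M\to[0,\infty)$ let $$\mathcal J_x(\nu)=\iint_{\mathbb S\times\mathbb R}\mathcal H\big(\mathrm{Cond}_{x,\,f(x)+u\tau(x)}(\nu)\big)\,\nu(df)\,\phi(u)\,du\in[0,\infty],$$ with $\phi$ the standard normal density, and $J_n(x)=\mathcal J_x(P_n^\xi)$. For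 a sequence $\varepsilon=(\varepsilon_n)$ of positive reals, a sequential design is *$\varepsilon$-quasi-SUR* for $\mathcal H$ if for some integer $n_0$, $J_n(X_{n+1})\le\inf_{x}J_n(x)+\varepsilon_n$ for all $n\ge n_0$. For a Gaussian random element $\xi$ of $\mathbb S$, let $\mathfrak P(\xi)$ be the set of random elements $\boldsymbol\nu$ of $\mathbb M$ with $\boldsymbol\nu=\mathbb P(\xi\in\cdot\mid\mathcal F')$ for some $\sigma$-algebra $\mathcal F'\subset\mathcal F$. A measurable $\mathcal H_1:\mathbb M\to\mathbb R$ * is *uniformly integrable over Gaussian conditional distributions* if, for every Gaussian random element $\xi$, the family $(\mathcal H_1(\boldsymbol\nu))_{\boldsymbol\nu\in\mathfrak P(\xi)}$ is uniformly integrable; * is *almost surely continuous over Gaussian conditional distributions* if, for every Gaussian random element $\xi$ and all $\boldsymbol\nu_n,\boldsymbol\nu_\infty\in\mathfrak P(\xi)$ with $\boldsymbol\nu_n\to\boldsymbol\nu_\infty$ a.s., $\mathcal H_1(\boldsymbol\nu_n)\to\mathcal H_1(\boldsymbol\nu_\infty)$ a.s.; * has the *supermartingale property* if, for every $P_0^\xi\in\mathbb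 M$ and every sequential design, $(\mathcal H_1(P_n^\xi))_{n\ge1}$ is an $(\mathcal F_n)$-supermartingale. **Theorem.** Let $\mathcal H:\mathbb M\to[0,\infty)$ be measurable with $\mathcal H=\mathcal H_0+\mathcal H_1$, where $\mathcal H_0(\nu)=\int_{\mathbb S}L_0\,d\nu$ for some $L_0\in\bigcap_{\nu\in\mathbb M}\mathcal L^1(\mathbb S,\mathcal S,\nu)$, and $\mathcal H_1:\mathbb M\to\mathbb R$ is measurable, uniformly integrable over Gaussian conditional distributions, almost surely continuous over Gaussian conditional distributions, and has the supermartingale property. Then: a) for any sequential design and any $n\ge0$, the sample paths of $J_n$ are finite on $\mathbb X$ and continuous on $\{x\in\mathbb X: s_n^2(x)>0\}$; b) for any sequence $\varepsilon=(\varepsilon_n)$ of positive real numbers, there exists an $\varepsilon$-quasi-SUR sequential design associated with $\mathcal H$. -/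

import Mathlib

open MeasureTheory ProbabilityTheory Filter Topology
open scoped NNReal ENNReal

universe u v

noncomputable section

namespace SUR

/-- `C(X, ℝ)` carries the Borel σ-algebra of the topology of uniform convergence
(the sup norm topology, as `X` is compact below). -/
instance instMeasurableSpaceC {X : Type u} [TopologicalSpace X] : MeasurableSpace C(X, ℝ) :=
  borel _

instance instBorelSpaceC {X : Type u} [TopologicalSpace X] : BorelSpace C(X, ℝ) := ⟨rfl⟩

/-- The set of all (possibly degenerate) Gaussian measures on `C(X, ℝ)`. -/
def GaussMeas (X : Type u) [TopologicalSpace X] : Type u :=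
  {ν : Measure C(X, ℝ) // IsGaussian ν}

variable {X : Type u} [MetricSpace X] [CompactSpace X]

/-- The σ-algebra generated by the evaluation maps `ν ↦ ν A`, `A` Borel. -/
instance instMeasurableSpaceGaussMeas : MeasurableSpace (GaussMeas X) :=
  inferInstanceAs (MeasurableSpace {ν : Measure C(X, ℝ) // IsGaussian ν})

instance instNonemptyGaussMeas : Nonempty (GaussMeas X) :=
  ⟨⟨Measure.dirac 0, inferInstance⟩⟩

/-- The mean function `m_ν`. -/
def mean (ν : GaussMeas X) (x : X) : ℝ := ∫ f, f x ∂ν.1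

/-- The covariance function `k_ν`. -/
def covFun (ν : GaussMeas X) (x y : X) : ℝ :=
  cov[fun f : C(X, ℝ) => f x, fun f : C(X, ℝ) => f y; ν.1]

/-- `GM m k` is the Gaussian measure on `C(X, ℝ)` with mean function `m` and covariance
function `k` (it is unique when it exists). -/
def GM (m : X → ℝ) (k : X → X → ℝ) : GaussMeas X :=
  Classical.epsilon fun ν : GaussMeas X => mean ν = m ∧ covFun ν = k

/-- The predictive variance `s_ν²(x) = k_ν(x, x) + τ²(x)` of a noisy observation at `x`. -/
def predVar (τ : C(X, ℝ≥0)) (ν : GaussMeas X) (x : X) : ℝ :=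
  covFun ν x x + (τ x : ℝ) ^ 2

/-- The conditioning operator: the posterior of `ν` after the value `z` has been observed at `x`
with noise standard deviation `τ x`. The inverse is the pseudo-inverse of the `1 × 1` matrix
`k_ν(x, x) + τ²(x)` (`0⁻¹ = 0` in `ℝ`). -/
def Cond (τ : C(X, ℝ≥0)) (x : X) (z : ℝ) (ν : GaussMeas X) : GaussMeas X :=
  GM (fun y => mean ν y + covFun ν y x * (predVar τ ν x)⁻¹ * (z - mean ν x))
    (fun y y' => covFun ν y y' - covFun ν y x * (predVar τ ν x)⁻¹ * covFun ν x y')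

/-- The functional `𝒥_x(ν) = ∬ H(Cond_{x, f(x) + u τ(x)}(ν)) ν(df) φ(u) du ∈ [0, ∞]`, for a
non-negative functional `H`. -/
def Jfun (τ : C(X, ℝ≥0)) (H : GaussMeas X → ℝ) (x : X) (ν : GaussMeas X) : ℝ≥0∞ :=
  ∫⁻ p : C(X, ℝ) × ℝ, ENNReal.ofReal (H (Cond τ x (p.1 x + p.2 * (τ x : ℝ)) ν))
    ∂(ν.1.prod (gaussianReal 0 1))

section Model

variable {Ω : Type v} [mΩ : MeasurableSpace Ω]

/-- `ξ` is a Gaussian random element of `C(X, ℝ)` with law `ν₀`, and `U 0, U 1, …` are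
i.i.d. standard normal variables, independent of `ξ`. -/
structure IsModel (P : Measure Ω) (ν₀ : GaussMeas X) (ξ : Ω → C(X, ℝ)) (U : ℕ → Ω → ℝ) :
    Prop where
  meas_ξ : Measurable ξ
  law_ξ : P.map ξ = ν₀.1
  meas_U : ∀ i, Measurable (U i)
  law_U : ∀ i, P.map (U i) = gaussianReal 0 1
  indep_U : iIndepFun U P
  indep_ξ_U : IndepFun ξ (fun ω i => U i ω) P

/-- The observations. Times are shifted by one: `D n`, `U n`, `obs … n` are
`X_{n+1}`, `U_{n+1}`, `Z_{n+1} = ξ(X_{n+1}) + τ(X_{n+1}) U_{n+1}`. -/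
def obs (τ : C(X, ℝ≥0)) (ξ : Ω → C(X, ℝ)) (U : ℕ → Ω → ℝ) (D : ℕ → Ω → X) (n : ℕ) (ω : Ω) : ℝ :=
  ξ ω (D n ω) + (τ (D n ω) : ℝ) * U n ω

/-- The posterior `P_n^ξ` after the first `n` observations, starting from the prior `ν₀`:
`P_0^ξ = ν₀` and `P_{n+1}^ξ = Cond_{X_{n+1}, Z_{n+1}}(P_n^ξ)`. -/
def posterior (τ : C(X, ℝ≥0)) (ν₀ : GaussMeas X) (ξ : Ω → C(X, ℝ)) (U : ℕ → Ω → ℝ)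
    (D : ℕ → Ω → X) : ℕ → Ω → GaussMeas X
  | 0, _ => ν₀
  | n + 1, ω => Cond τ (D n ω) (obs τ ξ U D n ω) (posterior τ ν₀ ξ U D n ω)

variable [MeasurableSpace X] [BorelSpace X]

/-- The σ-algebra `ℱ_n` generated by `X_1, Z_1, …, X_n, Z_n`. -/
@[reducible] def history (τ : C(X, ℝ≥0)) (ξ : Ω → C(X, ℝ)) (U : ℕ → Ω → ℝ) (D : ℕ → Ω → X) (n : ℕ) :
    MeasurableSpace Ω :=
  ⨆ i : ℕ, ⨆ _ : i < n,
    MeasurableSpace.comap (D i) inferInstance ⊔ MeasurableSpace.comap (obs τ ξ U D i) inferInstance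

/-- A sequential design: `X_{n+1}` is `ℱ_n`-measurable for every `n ≥ 0`. -/
def IsSequentialDesign (τ : C(X, ℝ≥0)) (ξ : Ω → C(X, ℝ)) (U : ℕ → Ω → ℝ) (D : ℕ → Ω → X) : Prop :=
  ∀ n, Measurable[history τ ξ U D n] (D n)

theorem history_mono (τ : C(X, ℝ≥0)) (ξ : Ω → C(X, ℝ)) (U : ℕ → Ω → ℝ) (D : ℕ → Ω → X) :
    Monotone (history τ ξ U D) := fun m n hmn => by
  refine iSup_mono fun i => iSup_le fun hi => ?_
  exact le_iSup_of_le (lt_of_lt_of_le hi hmn) le_rfl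

theorem history_le (τ : C(X, ℝ≥0)) {P : Measure Ω} {ν₀ : GaussMeas X} {ξ : Ω → C(X, ℝ)}
    {U : ℕ → Ω → ℝ} {D : ℕ → Ω → X} (hM : IsModel P ν₀ ξ U)
    (hD : IsSequentialDesign τ ξ U D) (n : ℕ) : history τ ξ U D n ≤ mΩ := by
  induction n using Nat.strong_induction_on with
  | _ n ih =>
    refine iSup_le fun i => iSup_le fun hi => ?_
    have hDi : Measurable (D i) := (hD i).mono (ih i hi) le_rfl
    have hev : Measurable fun ω => ξ ω (D i ω) := by
      have hc : Continuous fun p : C(X, ℝ) × X => p.1 p.2 := by fun_prop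
      exact hc.measurable.comp (hM.meas_ξ.prodMk hDi)
    have hτ : Measurable fun ω => (τ (D i ω) : ℝ) :=
      (NNReal.continuous_coe.comp τ.continuous).measurable.comp hDi
    exact sup_le hDi.comap_le (hev.add (hτ.mul (hM.meas_U i))).comap_le

/-- The filtration `(ℱ_n)_{n ≥ 1}`; the index `n` stands for time `n + 1`. -/
def shiftedFiltration (τ : C(X, ℝ≥0)) {P : Measure Ω} {ν₀ : GaussMeas X} {ξ : Ω → C(X, ℝ)}
    {U : ℕ → Ω → ℝ} {D : ℕ → Ω → X} (hM : IsModel P ν₀ ξ U)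
    (hD : IsSequentialDesign τ ξ U D) : Filtration ℕ mΩ where
  seq n := history τ ξ U D (n + 1)
  mono' := fun _ _ h => history_mono τ ξ U D (Nat.succ_le_succ h)
  le' n := history_le τ hM hD (n + 1)

/-- `(D n)` is an `ε`-quasi-SUR sequential design for `H`:
`J_n(X_{n+1}) ≤ inf J_n + ε_n` for all `n ≥ n₀`, for some `n₀`, where `J_n(x) = 𝒥_x(P_n^ξ)`. -/
def IsQuasiSUR (τ : C(X, ℝ≥0)) (H : GaussMeas X → ℝ) (ν₀ : GaussMeas X) (ξ : Ω → C(X, ℝ))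
    (U : ℕ → Ω → ℝ) (ε : ℕ → ℝ) (D : ℕ → Ω → X) : Prop :=
  IsSequentialDesign τ ξ U D ∧ ∃ n₀ : ℕ, ∀ n, n₀ ≤ n → ∀ ω,
    Jfun τ H (D n ω) (posterior τ ν₀ ξ U D n ω) ≤
      (⨅ x, Jfun τ H x (posterior τ ν₀ ξ U D n ω)) + ENNReal.ofReal (ε n)

end Model

section Properties

variable [MeasurableSpace X] [BorelSpace X]

/-- `H` has the supermartingale property (with respect to the noise level `τ`): for every Gaussian
prior and every sequential design, on any probability space, `(H(P_n^ξ))_{n ≥ 1}` is a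
supermartingale for `(ℱ_n)_{n ≥ 1}`. Below the index `n` stands for time `n + 1`. -/
def HasSupermartingaleProperty (τ : C(X, ℝ≥0)) (H : GaussMeas X → ℝ) : Prop :=
  ∀ (Ω : Type u) [MeasurableSpace Ω] (P : Measure Ω) [IsProbabilityMeasure P]
    (ν₀ : GaussMeas X) (ξ : Ω → C(X, ℝ)) (U : ℕ → Ω → ℝ) (D : ℕ → Ω → X)
    (hM : IsModel P ν₀ ξ U) (hD : IsSequentialDesign τ ξ U D),
    Supermartingale (fun n ω => H (posterior τ ν₀ ξ U D (n + 1) ω))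
      (shiftedFiltration τ hM hD) P

/-- `ν` is a Gaussian conditional distribution of `ξ`, i.e. `ν ∈ 𝔓(ξ)`: a random element of the
space of Gaussian measures with `ν = P(ξ ∈ · | 𝒢)` for some sub-σ-algebra `𝒢`. -/
def IsGaussCondDistrib {Ω : Type u} [mΩ : MeasurableSpace Ω] (P : Measure Ω) (ξ : Ω → C(X, ℝ))
    (ν : Ω → GaussMeas X) : Prop :=
  ∃ 𝒢 : MeasurableSpace Ω, 𝒢 ≤ mΩ ∧ Measurable[𝒢] ν ∧
    ∀ A : Set C(X, ℝ), MeasurableSet A →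
      (fun ω => (ν ω).1.real A) =ᵐ[P] P[(ξ ⁻¹' A).indicator (fun _ => (1 : ℝ)) | 𝒢]

/-- `ν n → ν∞`: uniform convergence of the mean functions and of the covariance functions. -/
def ConvGM (ν : ℕ → GaussMeas X) (ν' : GaussMeas X) : Prop :=
  TendstoUniformly (fun n x => mean (ν n) x) (fun x => mean ν' x) atTop ∧
    TendstoUniformly (fun n (p : X × X) => covFun (ν n) p.1 p.2)
      (fun p : X × X => covFun ν' p.1 p.2) atTop

/-- `H` is uniformly integrable over Gaussian conditional distributions: for every Gaussian random
element `ξ`, the family `(H(ν))_{ν ∈ 𝔓(ξ)}` is uniformly integrable. -/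
def IsUIGaussCond (H : GaussMeas X → ℝ) : Prop :=
  ∀ (Ω : Type u) [MeasurableSpace Ω] (P : Measure Ω) [IsProbabilityMeasure P] (ξ : Ω → C(X, ℝ)),
    Measurable ξ → IsGaussian (P.map ξ) →
    UniformIntegrable
      (fun (ν : {ν : Ω → GaussMeas X // IsGaussCondDistrib P ξ ν}) ω => H (ν.1 ω)) 1 P

/-- `H` is almost surely continuous over Gaussian conditional distributions: for every Gaussian
random element `ξ` and all `ν n, ν∞ ∈ 𝔓(ξ)` with `ν n → ν∞` a.s., `H(ν n) → H(ν∞)` a.s. -/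
def IsASContGaussCond (H : GaussMeas X → ℝ) : Prop :=
  ∀ (Ω : Type u) [MeasurableSpace Ω] (P : Measure Ω) [IsProbabilityMeasure P] (ξ : Ω → C(X, ℝ)),
    Measurable ξ → IsGaussian (P.map ξ) →
    ∀ (ν : ℕ → Ω → GaussMeas X) (ν' : Ω → GaussMeas X),
      (∀ n, IsGaussCondDistrib P ξ (ν n)) → IsGaussCondDistrib P ξ ν' →
      (∀ᵐ ω ∂P, ConvGM (fun n => ν n ω) (ν' ω)) →
      ∀ᵐ ω ∂P, Tendsto (fun n => H (ν n ω)) atTop (𝓝 (H (ν' ω)))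

end Properties

end SUR

end

/-! `J_n` depends on `ω` only through the posterior, so everything is proved for one fixed Gaussian
measure `ν`, on the product space `joint ν` of signal and noise. There the signal splits as residual
plus observation times gain, with residual and observation independent. Hence `Cond` is the law of
the residual translated by `z • gain` (`Cond_eq`), and conditioning on the noisy value at any `x`
gives a member of `𝔓(ξ)` for one common `ξ` (`isGaussCondDistrib_Cond`).

By the tower property the `L₀` part of `𝒥_x(ν)` does not depend on `x`; the `H₁` part is finite by
uniform integrability (`Jfun_eq`). Where the predictive variance is positive, the gain is continuous
in `x`, so the conditioned measures converge, and almost sure continuity with uniform integrability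
(Vitali) gives continuity of `𝒥`.

Continuity can fail where the predictive variance vanishes. But an observation there carries no
information, and by the supermartingale property no other observation does worse on average, so such
points maximise `𝒥` and never matter for the infimum. The infimum is thus attained along a countable
dense sequence, and taking the first `ε_n`-optimal index gives a measurable policy. -/

noncomputable section

set_option linter.unusedSectionVars false

namespace SUR

/-! ### Gaussian measures on `C(X, ℝ)`: mean, covariance, uniqueness. -/

section GaussianMeasures

variable {X : Type u} [MetricSpace X] [CompactSpace X]

instance instIsGaussianVal (ν : GaussMeas X) : IsGaussian ν.1 := ν.2

/-- The evaluation functional at `x`. -/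
def ev (x : X) : C(X, ℝ) →L[ℝ] ℝ := ContinuousMap.evalCLM ℝ x

@[simp] theorem ev_apply (x : X) (f : C(X, ℝ)) : ev x f = f x := rfl

theorem integrable_gauss (ν : GaussMeas X) : Integrable (fun f : C(X, ℝ) => f) ν.1 :=
  IsGaussian.integrable_id

theorem memLp_two_gauss (ν : GaussMeas X) : MemLp (fun f : C(X, ℝ) => f) 2 ν.1 :=
  IsGaussian.memLp_two_id

/-- The mean of `ν` as an element of `C(X, ℝ)`. -/
def meanC (ν : GaussMeas X) : C(X, ℝ) := ∫ f, f ∂ν.1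

theorem integral_dual (ν : GaussMeas X) (L : C(X, ℝ) →L[ℝ] ℝ) :
    ∫ f, L f ∂ν.1 = L (meanC ν) :=
  L.integral_comp_comm (integrable_gauss ν)

theorem meanC_apply (ν : GaussMeas X) (x : X) : meanC ν x = mean ν x :=
  (integral_dual ν (ev x)).symm

/-- The vector `Cov(L, ·)` representing the covariance of the functional `L` with all
evaluations. -/
def covDual (ν : GaussMeas X) (L : C(X, ℝ) →L[ℝ] ℝ) : C(X, ℝ) :=
  ∫ f, (L f - L (meanC ν)) • (f - meanC ν) ∂ν.1

theorem integrable_covDual (ν : GaussMeas X) (L : C(X, ℝ) →L[ℝ] ℝ) :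
    Integrable (fun f => (L f - L (meanC ν)) • (f - meanC ν)) ν.1 := by
  have h : MemLp (fun f : C(X, ℝ) => f - meanC ν) 2 ν.1 :=
    (memLp_two_gauss ν).sub (memLp_const _)
  have h' : MemLp (fun f : C(X, ℝ) => L f - L (meanC ν)) 2 ν.1 :=
    (IsGaussian.memLp_dual ν.1 L 2 (by norm_num)).sub (memLp_const _)
  exact memLp_one_iff_integrable.1 (h.smul h')

theorem dual_covDual (ν : GaussMeas X) (L L' : C(X, ℝ) →L[ℝ] ℝ) :
    L' (covDual ν L) = cov[L, L'; ν.1] := by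
  rw [covDual, ← L'.integral_comp_comm (integrable_covDual ν L), covariance]
  simp only [integral_dual, map_smul, map_sub, smul_eq_mul]

theorem covFun_eq (ν : GaussMeas X) (x y : X) : covFun ν x y = cov[ev x, ev y; ν.1] := rfl

theorem covFun_comm (ν : GaussMeas X) (x y : X) : covFun ν x y = covFun ν y x :=
  covariance_comm _ _

theorem covDual_ev_apply (ν : GaussMeas X) (x y : X) :
    covDual ν (ev x) y = covFun ν x y :=
  dual_covDual ν (ev x) (ev y)

/-- Evaluations determine the covariance of arbitrary functionals without any description of the
dual: `k` fixes the vectors `covDual ν (ev x)`, and symmetry of the covariance then fixes `covDual ν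
L` at every point. -/
theorem gaussMeas_ext {ν ν' : GaussMeas X} (hm : mean ν = mean ν')
    (hk : covFun ν = covFun ν') : ν = ν' := by
  refine Subtype.ext (IsGaussian.ext_covarianceBilinDual ?_ ?_)
  · change meanC ν = meanC ν'
    ext x
    rw [meanC_apply, meanC_apply, hm]
  · have h1 : ∀ x, covDual ν (ev x) = covDual ν' (ev x) := fun x => by
      ext y
      rw [covDual_ev_apply, covDual_ev_apply, hk]
    have h2 : ∀ L : C(X, ℝ) →L[ℝ] ℝ, covDual ν L = covDual ν' L := fun L => by
      ext y
      rw [← ev_apply, ← ev_apply, dual_covDual, dual_covDual, covariance_comm,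
        ← dual_covDual, h1, dual_covDual, covariance_comm]
    ext L L'
    rw [covarianceBilinDual_eq_covariance (memLp_two_gauss ν),
      covarianceBilinDual_eq_covariance (memLp_two_gauss ν'), ← dual_covDual, h2, dual_covDual]

theorem GM_eq_of {m : X → ℝ} {k : X → X → ℝ} {ν : GaussMeas X} (hm : mean ν = m)
    (hk : covFun ν = k) : GM m k = ν := by
  have h : mean (GM m k) = m ∧ covFun (GM m k) = k :=
    Classical.epsilon_spec (p := fun ν : GaussMeas X => mean ν = m ∧ covFun ν = k) ⟨ν, hm, hk⟩
  exact gaussMeas_ext (h.1.trans hm.symm) (h.2.trans hk.symm)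

variable (τ : C(X, ℝ≥0))

theorem covFun_self (ν : GaussMeas X) (x : X) : covFun ν x x = Var[ev x; ν.1] :=
  covariance_self (ev x).continuous.aemeasurable

theorem covFun_self_nonneg (ν : GaussMeas X) (x : X) : 0 ≤ covFun ν x x := by
  rw [covFun_self]
  exact variance_nonneg _ _

theorem predVar_nonneg (ν : GaussMeas X) (x : X) : 0 ≤ predVar τ ν x :=
  add_nonneg (covFun_self_nonneg ν x) (sq_nonneg _)

theorem covDual_ev_eq_zero {ν : GaussMeas X} {x : X} (h : covFun ν x x = 0) :
    covDual ν (ev x) = 0 := by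
  rw [covFun_self] at h
  have h2 := ae_eq_integral_of_variance_eq_zero (IsGaussian.memLp_dual ν.1 (ev x) 2 (by norm_num)) h
  refine integral_eq_zero_of_ae ?_
  filter_upwards [h2] with f hf
  rw [integral_dual] at hf
  simp [hf]

/-- The gain `k_ν(·, x) / s_ν²(x)` of an observation at `x`. -/
def gain (ν : GaussMeas X) (x : X) : C(X, ℝ) := (predVar τ ν x)⁻¹ • covDual ν (ev x)

/-- In the degenerate case both sides vanish, since zero variance at `x` kills all covariances with
`f x`. This spares the covariance computations below a case distinction. -/
theorem predVar_smul_gain (ν : GaussMeas X) (x : X) :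
    predVar τ ν x • gain τ ν x = covDual ν (ev x) := by
  rcases eq_or_ne (predVar τ ν x) 0 with h | h
  · have h0 : covFun ν x x = 0 := le_antisymm
      (by rw [← h, predVar]; exact le_add_of_nonneg_right (sq_nonneg _)) (covFun_self_nonneg ν x)
    rw [h, zero_smul, covDual_ev_eq_zero h0]
  · rw [gain, smul_smul, mul_inv_cancel₀ h, one_smul]

theorem gain_apply (ν : GaussMeas X) (x y : X) :
    gain τ ν x y = covFun ν y x * (predVar τ ν x)⁻¹ := by
  rw [gain, ContinuousMap.smul_apply, covDual_ev_apply, covFun_comm, smul_eq_mul, mul_comm]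

/-! ### Signal, noise, and the explicit form of conditioning. -/

/-- The joint law of the signal and of the noise. -/
def joint (ν : GaussMeas X) : Measure (C(X, ℝ) × ℝ) := ν.1.prod (gaussianReal 0 1)

instance instIsGaussianJoint (ν : GaussMeas X) : IsGaussian (joint ν) := by
  unfold joint; infer_instance

/-- The noisy observation at `x`. -/
def noisy (x : X) : C(X, ℝ) × ℝ →L[ℝ] ℝ :=
  (ev x).comp (ContinuousLinearMap.fst ℝ _ _) +
    (τ x : ℝ) • ContinuousLinearMap.snd ℝ C(X, ℝ) ℝ

theorem noisy_apply (x : X) (p : C(X, ℝ) × ℝ) : noisy τ x p = p.1 x + p.2 * (τ x : ℝ) := by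
  simp [noisy, mul_comm]

/-- The residual `ξ - Z c`, where `c` is the gain and `Z` the noisy observation at `x`. -/
def resid (ν : GaussMeas X) (x : X) : C(X, ℝ) × ℝ →L[ℝ] C(X, ℝ) :=
  ContinuousLinearMap.fst ℝ _ _ - (noisy τ x).smulRight (gain τ ν x)

theorem resid_apply (ν : GaussMeas X) (x : X) (p : C(X, ℝ) × ℝ) :
    resid τ ν x p = p.1 - noisy τ x p • gain τ ν x := rfl

theorem resid_add (ν : GaussMeas X) (x : X) (p : C(X, ℝ) × ℝ) :
    resid τ ν x p + noisy τ x p • gain τ ν x = p.1 := by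
  rw [resid_apply, sub_add_cancel]

theorem memLp_joint (ν : GaussMeas X) (L : C(X, ℝ) × ℝ →L[ℝ] ℝ) : MemLp L 2 (joint ν) :=
  IsGaussian.memLp_dual _ L 2 (by norm_num)

theorem memLp_fst (ν : GaussMeas X) (L : C(X, ℝ) →L[ℝ] ℝ) :
    MemLp (fun p : C(X, ℝ) × ℝ => L p.1) 2 (joint ν) :=
  memLp_joint ν (L.comp (.fst ℝ _ _))

theorem memLp_mul_snd (ν : GaussMeas X) (c : ℝ) :
    MemLp (fun p : C(X, ℝ) × ℝ => c * p.2) 2 (joint ν) :=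
  memLp_joint ν (c • .snd ℝ _ _)

theorem memLp_snd (ν : GaussMeas X) : MemLp (fun p : C(X, ℝ) × ℝ => p.2) 2 (joint ν) :=
  memLp_joint ν (.snd ℝ _ _)

theorem memLp_mul_noisy (ν : GaussMeas X) (x : X) (c : ℝ) :
    MemLp (fun p => c * noisy τ x p) 2 (joint ν) :=
  memLp_joint ν (c • noisy τ x)

theorem memLp_resid (ν : GaussMeas X) (x : X) (L : C(X, ℝ) →L[ℝ] ℝ) :
    MemLp (fun p => L (resid τ ν x p)) 2 (joint ν) :=
  memLp_joint ν (L.comp (resid τ ν x))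

theorem map_fst_joint (ν : GaussMeas X) : (joint ν).map Prod.fst = ν.1 := by
  simp [joint]

theorem map_snd_joint (ν : GaussMeas X) : (joint ν).map Prod.snd = gaussianReal 0 1 := by
  simp [joint]

theorem cov_fst_fst (ν : GaussMeas X) (L L' : C(X, ℝ) →L[ℝ] ℝ) :
    cov[fun p => L p.1, fun p => L' p.1; joint ν] = cov[L, L'; ν.1] := by
  rw [← map_fst_joint ν, covariance_map (by fun_prop) (by fun_prop) (by fun_prop)]
  rfl

theorem cov_fst_snd (ν : GaussMeas X) (L : C(X, ℝ) →L[ℝ] ℝ) :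
    cov[fun p => L p.1, fun p => p.2; joint ν] = 0 :=
  (indepFun_prod (X := L) (Y := fun u : ℝ => u) (by fun_prop) (by fun_prop)).covariance_eq_zero
    (memLp_fst ν L) (memLp_snd ν)

theorem cov_snd_snd (ν : GaussMeas X) :
    cov[fun p => p.2, fun p => p.2; joint ν] = 1 := by
  have h : cov[(fun u : ℝ => u), (fun u : ℝ => u); gaussianReal 0 1] = 1 := by
    rw [covariance_self (by fun_prop), variance_fun_id_gaussianReal]; rfl
  rw [← h, ← map_snd_joint ν, covariance_map (by fun_prop) (by fun_prop) (by fun_prop)]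
  rfl

theorem cov_fst_noisy (ν : GaussMeas X) (L : C(X, ℝ) →L[ℝ] ℝ) (x : X) :
    cov[fun p => L p.1, noisy τ x; joint ν] = L (covDual ν (ev x)) := by
  have h : (noisy τ x : C(X, ℝ) × ℝ → ℝ) = (fun p => ev x p.1) + fun p => (τ x : ℝ) * p.2 := rfl
  rw [h, covariance_add_right (memLp_fst ν L)
    (memLp_fst ν (ev x))
    (memLp_mul_snd ν (τ x)), cov_fst_fst, covariance_const_mul_right,
    cov_fst_snd, mul_zero, add_zero, dual_covDual, covariance_comm]

theorem cov_noisy_noisy (ν : GaussMeas X) (x : X) :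
    cov[noisy τ x, noisy τ x; joint ν] = predVar τ ν x := by
  have h : (noisy τ x : C(X, ℝ) × ℝ → ℝ) = (fun p => ev x p.1) + fun p => (τ x : ℝ) * p.2 := rfl
  have h2 : cov[fun p => (τ x : ℝ) * p.2, noisy τ x; joint ν] = (τ x : ℝ) ^ 2 := by
    rw [h, covariance_const_mul_left, covariance_add_right (memLp_snd ν)
      (memLp_fst ν (ev x)) (memLp_mul_snd ν (τ x)),
      covariance_comm, cov_fst_snd, covariance_const_mul_right, cov_snd_snd]
    ring
  conv_lhs => arg 1; rw [h]
  rw [covariance_add_left (memLp_fst ν (ev x))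
    (memLp_mul_snd ν (τ x)) (memLp_joint ν _), h2, cov_fst_noisy, ev_apply,
    covDual_ev_apply, predVar]

/-- The gain is the regression coefficient of the signal on the observation. -/
theorem cov_resid_noisy (ν : GaussMeas X) (L : C(X, ℝ) →L[ℝ] ℝ) (x : X) :
    cov[fun p => L (resid τ ν x p), noisy τ x; joint ν] = 0 := by
  have h : (fun p => L (resid τ ν x p)) =
      (fun p => L p.1) - fun p => L (gain τ ν x) * noisy τ x p := by
    ext p
    simp [resid_apply, mul_comm]
  rw [h, covariance_sub_left (memLp_fst ν L)
    (memLp_mul_noisy τ ν x _) (memLp_joint ν _), cov_fst_noisy,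
    covariance_const_mul_left, cov_noisy_noisy, ← predVar_smul_gain τ ν x, map_smul, smul_eq_mul]
  ring

theorem cov_resid_resid (ν : GaussMeas X) (x : X) (L L' : C(X, ℝ) →L[ℝ] ℝ) :
    cov[fun p => L (resid τ ν x p), fun p => L' (resid τ ν x p); joint ν] =
      cov[L, L'; ν.1] - L (covDual ν (ev x)) * L' (gain τ ν x) := by
  have h : (fun p => L' (resid τ ν x p)) =
      (fun p => L' p.1) - fun p => L' (gain τ ν x) * noisy τ x p := by
    ext p
    simp [resid_apply, mul_comm]
  have h' : (fun p => L (resid τ ν x p)) =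
      (fun p => L p.1) - fun p => L (gain τ ν x) * noisy τ x p := by
    ext p
    simp [resid_apply, mul_comm]
  -- Only the second residual is expanded at this point: its observation term is orthogonal to the
  -- first residual.
  rw [h, covariance_sub_right (memLp_resid τ ν x L)
    (memLp_fst ν L') (memLp_mul_noisy τ ν x _),
    covariance_const_mul_right, cov_resid_noisy, mul_zero, sub_zero, h',
    covariance_sub_left (memLp_fst ν L)
      (memLp_mul_noisy τ ν x _) (memLp_fst ν L'),
    cov_fst_fst, covariance_const_mul_left, covariance_comm (noisy τ x), cov_fst_noisy,
    ← predVar_smul_gain τ ν x, map_smul, map_smul, smul_eq_mul, smul_eq_mul]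
  ring

/-- Both are linear images of one Gaussian vector, hence jointly Gaussian, so zero covariance
suffices. -/
theorem indepFun_resid_noisy (ν : GaussMeas X) (x : X) :
    IndepFun (resid τ ν x) (noisy τ x) (joint ν) := by
  have hg : HasGaussianLaw (fun p => (resid τ ν x p, noisy τ x p)) (joint ν) :=
    IsGaussian.hasGaussianLaw_id.map ((resid τ ν x).prod (noisy τ x))
  refine hg.indepFun_of_covariance_strongDual fun L₁ L₂ => ?_
  -- A functional on `ℝ` is multiplication by its value at `1`.
  have h : L₂ ∘ noisy τ x = fun p => L₂ 1 * noisy τ x p := by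
    ext p
    rw [Function.comp_apply, mul_comm, ← smul_eq_mul, ← map_smul, smul_eq_mul, mul_one]
  rw [h, covariance_const_mul_right]
  exact mul_eq_zero_of_right _ (cov_resid_noisy τ ν L₁ x)

/-- The law of `resid + z • gain`, which is an explicit form of `Cond`. -/
def condLaw (x : X) (z : ℝ) (ν : GaussMeas X) : GaussMeas X :=
  ⟨((joint ν).map (resid τ ν x)).map (· + z • gain τ ν x), inferInstance⟩

theorem integral_condLaw (x : X) (z : ℝ) (ν : GaussMeas X) {E : Type*} [NormedAddCommGroup E]
    [NormedSpace ℝ E] {g : C(X, ℝ) → E} (hg : StronglyMeasurable g) :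
    ∫ f, g f ∂(condLaw τ x z ν).1 = ∫ p, g (resid τ ν x p + z • gain τ ν x) ∂(joint ν) := by
  rw [condLaw, integral_map (by fun_prop) hg.aestronglyMeasurable, integral_map (by fun_prop)]
  exact (hg.comp_measurable (by fun_prop)).aestronglyMeasurable

theorem integral_fst_joint (ν : GaussMeas X) (L : C(X, ℝ) →L[ℝ] ℝ) :
    ∫ p, L p.1 ∂(joint ν) = L (meanC ν) := by
  rw [← integral_dual]
  conv_rhs => rw [← map_fst_joint ν]
  rw [integral_map (by fun_prop) (by fun_prop)]

theorem integral_noisy (ν : GaussMeas X) (x : X) : ∫ p, noisy τ x p ∂(joint ν) = mean ν x := by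
  have h : ∫ p, p.2 ∂(joint ν) = 0 := by
    have h1 : ∫ u : ℝ, u ∂(gaussianReal 0 1) = 0 := integral_id_gaussianReal
    rw [← map_snd_joint ν, integral_map (by fun_prop) (by fun_prop)] at h1
    exact h1
  have h1 : Integrable (fun p => ev x p.1) (joint ν) :=
    (memLp_fst ν (ev x)).integrable (by norm_num)
  have h2 : Integrable (fun p => (τ x : ℝ) * p.2) (joint ν) :=
    (memLp_mul_snd ν (τ x)).integrable (by norm_num)
  have h3 : (noisy τ x : C(X, ℝ) × ℝ → ℝ) = fun p => ev x p.1 + (τ x : ℝ) * p.2 := rfl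
  rw [h3, integral_add h1 h2, integral_fst_joint, integral_const_mul, h, ev_apply, meanC_apply,
    mul_zero, add_zero]

theorem mean_condLaw (x : X) (z : ℝ) (ν : GaussMeas X) (y : X) :
    mean (condLaw τ x z ν) y = mean ν y + gain τ ν x y * (z - mean ν x) := by
  rw [mean, integral_condLaw τ x z ν (g := fun f => f y) (by
    exact (ev y).continuous.stronglyMeasurable)]
  have h : ∀ p, (resid τ ν x p + z • gain τ ν x) y =
      (ev y p.1 - gain τ ν x y * noisy τ x p) + z * gain τ ν x y := fun p => by
    simp [resid_apply, mul_comm]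
  have h1 : Integrable (fun p => ev y p.1) (joint ν) :=
    (memLp_fst ν (ev y)).integrable (by norm_num)
  have h2 : Integrable (fun p => gain τ ν x y * noisy τ x p) (joint ν) :=
    ((memLp_joint ν (noisy τ x)).integrable (by norm_num)).const_mul _
  simp_rw [h]
  rw [integral_add (by exact h1.sub h2) (integrable_const _), integral_sub h1 h2, integral_fst_joint,
    integral_const_mul, integral_noisy, ev_apply, meanC_apply, integral_const]
  simp only [probReal_univ, one_smul]
  ring

theorem covFun_condLaw (x : X) (z : ℝ) (ν : GaussMeas X) (y y' : X) :
    covFun (condLaw τ x z ν) y y' = covFun ν y y' - gain τ ν x y * covFun ν x y' := by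
  rw [covFun_eq, condLaw, covariance_map (by fun_prop) (by fun_prop) (by fun_prop),
    covariance_map (Measurable.aestronglyMeasurable (by fun_prop))
      (Measurable.aestronglyMeasurable (by fun_prop)) (by fun_prop)]
  have h : ∀ w, ((ev w : C(X, ℝ) → ℝ) ∘ (· + z • gain τ ν x)) ∘ resid τ ν x =
      fun p => ev w (resid τ ν x p) + z * gain τ ν x w := fun w => by
    ext p; simp
  have hi : ∀ w, Integrable (fun p => ev w (resid τ ν x p)) (joint ν) := fun w =>
    (memLp_resid τ ν x (ev w)).integrable (by norm_num)
  rw [h, h, covariance_add_const_left (hi y), covariance_add_const_right (hi y'),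
    cov_resid_resid]
  rw [covFun_eq, ev_apply, ev_apply, covDual_ev_apply, gain_apply, gain_apply, covFun_comm ν x y,
    covFun_comm ν x y']
  ring

/-- `condLaw` witnesses that the choice in `GM` is not vacuous, and uniqueness identifies the two.
-/
theorem Cond_eq (x : X) (z : ℝ) (ν : GaussMeas X) : Cond τ x z ν = condLaw τ x z ν := by
  refine GM_eq_of (funext fun y => ?_) (funext fun y => funext fun y' => ?_)
  · rw [mean_condLaw, gain_apply]
  · rw [covFun_condLaw, gain_apply]

end GaussianMeasures

/-! ### Joint measurability of the conditioning operator and of `𝒥`. -/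

section Measurability

variable {X : Type u} [MetricSpace X] [CompactSpace X]

/-- The tautological kernel from Gaussian measures to `C(X, ℝ)`. -/
def gaussKernel (X : Type u) [MetricSpace X] [CompactSpace X] : Kernel (GaussMeas X) C(X, ℝ) :=
  ⟨fun ν => ν.1, measurable_subtype_coe⟩

instance instIsMarkovGaussKernel : IsMarkovKernel (gaussKernel X) :=
  ⟨fun ν => inferInstanceAs (IsProbabilityMeasure ν.1)⟩

/-- The kernel `ν ↦ joint ν`. -/
def jointKernel (X : Type u) [MetricSpace X] [CompactSpace X] :
    Kernel (GaussMeas X) (C(X, ℝ) × ℝ) :=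
  gaussKernel X ×ₖ Kernel.const _ (gaussianReal 0 1)

instance instIsMarkovJointKernel : IsMarkovKernel (jointKernel X) := by
  unfold jointKernel; infer_instance

theorem jointKernel_apply (ν : GaussMeas X) : jointKernel X ν = joint ν := by
  rw [jointKernel, Kernel.prod_apply, Kernel.const_apply]
  rfl

theorem measurable_meanC : Measurable (meanC : GaussMeas X → C(X, ℝ)) :=
  (StronglyMeasurable.integral_kernel_prod_right' (κ := gaussKernel X)
    (f := fun p : GaussMeas X × C(X, ℝ) => p.2) (by fun_prop)).measurable

variable [MeasurableSpace X] [BorelSpace X]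

theorem measurable_eval_uncurry : Measurable fun p : C(X, ℝ) × X => p.1 p.2 :=
  (by fun_prop : Continuous fun p : C(X, ℝ) × X => p.1 p.2).measurable

theorem measurable_covDual :
    Measurable fun q : GaussMeas X × X => covDual q.1 (ev q.2) := by
  have hm : Measurable fun p : (GaussMeas X × X) × C(X, ℝ) => meanC p.1.1 :=
    measurable_meanC.comp (by fun_prop)
  have h1 : Measurable fun p : (GaussMeas X × X) × C(X, ℝ) => p.2 p.1.2 :=
    measurable_eval_uncurry.comp
      (f := fun p : (GaussMeas X × X) × C(X, ℝ) => (p.2, p.1.2)) (by fun_prop)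
  have h2 : Measurable fun p : (GaussMeas X × X) × C(X, ℝ) => meanC p.1.1 p.1.2 :=
    measurable_eval_uncurry.comp (hm.prodMk (by fun_prop))
  exact (StronglyMeasurable.integral_kernel_prod_right'
    (κ := (gaussKernel X).comap Prod.fst measurable_fst)
    (f := fun p : (GaussMeas X × X) × C(X, ℝ) =>
      (p.2 p.1.2 - meanC p.1.1 p.1.2) • (p.2 - meanC p.1.1))
    ((h1.sub h2).smul (measurable_snd.sub hm)).stronglyMeasurable).measurable

variable (τ : C(X, ℝ≥0))

theorem measurable_coe_noise : Measurable fun x => (τ x : ℝ) :=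
  (NNReal.continuous_coe.comp τ.continuous).measurable

theorem measurable_predVar : Measurable fun q : GaussMeas X × X => predVar τ q.1 q.2 := by
  have h : Measurable fun q : GaussMeas X × X => covDual q.1 (ev q.2) q.2 :=
    measurable_eval_uncurry.comp (measurable_covDual.prodMk measurable_snd)
  simp only [covDual_ev_apply] at h
  exact h.add (((measurable_coe_noise τ).comp measurable_snd).pow_const 2)

theorem measurable_gain : Measurable fun q : GaussMeas X × X => gain τ q.1 q.2 :=
  (measurable_predVar τ).inv.smul measurable_covDual

theorem measurable_noisy : Measurable fun q : X × (C(X, ℝ) × ℝ) => noisy τ q.1 q.2 := by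
  simp only [noisy_apply]
  exact (measurable_eval_uncurry.comp (g := fun p : C(X, ℝ) × X => p.1 p.2)
    (f := fun q : X × (C(X, ℝ) × ℝ) => (q.2.1, q.1)) (by fun_prop)).add
    (measurable_snd.snd.mul ((measurable_coe_noise τ).comp measurable_fst))

theorem measurable_Cond :
    Measurable fun q : (X × ℝ) × GaussMeas X => Cond τ q.1.1 q.1.2 q.2 := by
  simp only [Cond_eq]
  refine Measurable.subtype_mk (Measure.measurable_of_measurable_coe _ fun A hA => ?_)
  have hg : Measurable fun r : ((X × ℝ) × GaussMeas X) × (C(X, ℝ) × ℝ) =>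
      gain τ r.1.2 r.1.1.1 :=
    (measurable_gain τ).comp (g := fun q : GaussMeas X × X => gain τ q.1 q.2)
      (f := fun r : ((X × ℝ) × GaussMeas X) × (C(X, ℝ) × ℝ) => (r.1.2, r.1.1.1)) (by fun_prop)
  have hn : Measurable fun r : ((X × ℝ) × GaussMeas X) × (C(X, ℝ) × ℝ) =>
      noisy τ r.1.1.1 r.2 :=
    (measurable_noisy τ).comp (g := fun q : X × (C(X, ℝ) × ℝ) => noisy τ q.1 q.2)
      (f := fun r : ((X × ℝ) × GaussMeas X) × (C(X, ℝ) × ℝ) => (r.1.1.1, r.2)) (by fun_prop)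
  have hr : Measurable fun r : ((X × ℝ) × GaussMeas X) × (C(X, ℝ) × ℝ) =>
      resid τ r.1.2 r.1.1.1 r.2 + r.1.1.2 • gain τ r.1.2 r.1.1.1 := by
    simp only [resid_apply]
    exact (measurable_snd.fst.sub (hn.smul hg)).add (measurable_fst.fst.snd.smul hg)
  have h := Measurable.lintegral_kernel_prod_right'
    (κ := (jointKernel X).comap (Prod.snd : (X × ℝ) × GaussMeas X → _) measurable_snd)
    ((measurable_one.indicator hA).comp hr)
  convert h using 2 with q
  rw [Kernel.comap_apply, jointKernel_apply, Measure.map_map (by fun_prop) (by fun_prop),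
    Measure.map_apply (by fun_prop) hA, ← lintegral_indicator_one
      ((by fun_prop : Measurable _) hA)]
  rfl

/-- A fixed `x` is enough: the selection only compares values along a countable sequence of points.
-/
theorem measurable_Jfun {H : GaussMeas X → ℝ} (hH : Measurable H) (x : X) :
    Measurable fun ν => Jfun τ H x ν := by
  have hn : Measurable fun r : GaussMeas X × (C(X, ℝ) × ℝ) => noisy τ x r.2 := by fun_prop
  simp only [noisy_apply] at hn
  have hC : Measurable fun r : GaussMeas X × (C(X, ℝ) × ℝ) =>
      Cond τ x (r.2.1 x + r.2.2 * (τ x : ℝ)) r.1 :=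
    (measurable_Cond τ).comp (((measurable_const (a := x)).prodMk hn).prodMk measurable_fst)
  have h := Measurable.lintegral_kernel_prod_right' (κ := jointKernel X)
    (hH.comp hC).ennreal_ofReal
  simp only [jointKernel_apply] at h
  exact h

end Measurability

/-! ### Disintegration along a noisy observation. -/

section Tower

variable {X : Type u} [MetricSpace X] [CompactSpace X] (τ : C(X, ℝ≥0))

theorem map_resid_noisy (ν : GaussMeas X) (x : X) :
    (joint ν).map (fun p => (resid τ ν x p, noisy τ x p)) =
      ((joint ν).map (resid τ ν x)).prod ((joint ν).map (noisy τ x)) :=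
  (indepFun_iff_map_prod_eq_prod_map_map (by fun_prop) (by fun_prop)).1
    (indepFun_resid_noisy τ ν x)

/-- Disintegration of the joint law of the signal and a noisy observation. -/
theorem integral_condLaw_noisy (ν : GaussMeas X) (x : X) {h : C(X, ℝ) × ℝ → ℝ}
    (hm : StronglyMeasurable h) (hi : Integrable (fun p => h (p.1, noisy τ x p)) (joint ν)) :
    Integrable (fun p => ∫ f, h (f, noisy τ x p) ∂(condLaw τ x (noisy τ x p) ν).1) (joint ν) ∧
      ∫ p, (∫ f, h (f, noisy τ x p) ∂(condLaw τ x (noisy τ x p) ν).1) ∂(joint ν) =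
        ∫ p, h (p.1, noisy τ x p) ∂(joint ν) := by
  set ρ := (joint ν).map (resid τ ν x) with h_ρ
  set N := (joint ν).map (noisy τ x) with hN
  -- `k` is `h` in the coordinates (residual, observation), whose joint law is a product, so that
  -- Fubini applies.
  set k : C(X, ℝ) × ℝ → ℝ := fun q => h (q.1 + q.2 • gain τ ν x, q.2) with hk
  have hkm : StronglyMeasurable k := hm.comp_measurable (by fun_prop)
  have hpm : Measurable fun p => (resid τ ν x p, noisy τ x p) := by fun_prop
  have hcomp : (fun p => h (p.1, noisy τ x p)) =
      fun p => k (resid τ ν x p, noisy τ x p) := by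
    ext p
    simp only [hk, resid_add]
  have hin : ∀ z, ∫ f, h (f, z) ∂(condLaw τ x z ν).1 = ∫ w, k (w, z) ∂ρ := fun z => by
    rw [integral_condLaw τ x z ν (g := fun f => h (f, z)) (hm.comp_measurable (by fun_prop)), h_ρ,
      integral_map (by fun_prop) (by exact (hkm.comp_measurable
        (by fun_prop : Measurable fun w : C(X, ℝ) => (w, z))).aestronglyMeasurable)]
  simp only [hin]
  rw [hcomp] at hi ⊢
  have hi' : Integrable k (ρ.prod N) := by
    rw [h_ρ, hN, ← map_resid_noisy]
    exact (integrable_map_measure hkm.aestronglyMeasurable hpm.aemeasurable).2 hi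
  have hz := hi'.integral_prod_right
  refine ⟨hz.comp_measurable (by fun_prop), ?_⟩
  rw [← integral_map (f := fun z => ∫ w, k (w, z) ∂ρ) (φ := noisy τ x) (by fun_prop)
    hz.aestronglyMeasurable, ← integral_prod_symm k hi', h_ρ, hN, ← map_resid_noisy,
    integral_map (by fun_prop) hkm.aestronglyMeasurable]

variable [MeasurableSpace X] [BorelSpace X]

theorem measurable_Cond_left (ν : GaussMeas X) (x : X) : Measurable fun z => Cond τ x z ν :=
  (measurable_Cond τ).comp (f := fun z : ℝ => ((x, z), ν)) (by fun_prop)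

/-- This makes the hypotheses on `H₁` applicable. The random element `Prod.fst` is the same for all
`x`; only the conditioning σ-algebra changes. -/
theorem isGaussCondDistrib_Cond (ν : GaussMeas X) (x : X) :
    IsGaussCondDistrib (joint ν) Prod.fst fun p => Cond τ x (noisy τ x p) ν := by
  have hn : Measurable (noisy τ x) := by fun_prop
  refine ⟨MeasurableSpace.comap (noisy τ x) inferInstance, hn.comap_le,
    (measurable_Cond_left τ ν x).comp (comap_measurable _), fun A hA => ?_⟩
  have hmeas : Measurable fun z => (Cond τ x z ν).1.real A :=
    ((Measure.measurable_coe hA).comp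
      (measurable_subtype_coe.comp (measurable_Cond_left τ ν x))).ennreal_toReal
  have hintA : Integrable ((Prod.fst ⁻¹' A).indicator fun _ => (1 : ℝ)) (joint ν) :=
    (integrable_const _).indicator (measurable_fst hA)
  have hint : Integrable (fun p => (Cond τ x (noisy τ x p) ν).1.real A) (joint ν) := by
    refine Integrable.of_bound (C := 1) (hmeas.comp hn).aestronglyMeasurable
      (Eventually.of_forall fun p => ?_)
    rw [Real.norm_of_nonneg measureReal_nonneg]
    exact measureReal_le_one
  refine ae_eq_condExp_of_forall_setIntegral_eq hn.comap_le hintA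
    (fun s _ _ => hint.integrableOn) ?_ ?_
  · rintro s ⟨B, hB, rfl⟩ -
    -- The defining identity of the conditional expectation on `{noisy ∈ B}` is the disintegration
    -- of this indicator.
    have key := (integral_condLaw_noisy τ ν x (h := (A ×ˢ B).indicator fun _ => (1 : ℝ))
      (stronglyMeasurable_const.indicator (hA.prod hB)) ?_).2
    · rw [← integral_indicator (hn hB), ← integral_indicator (hn hB)]
      convert key using 2
      · ext p
        by_cases hp : noisy τ x p ∈ B
        · rw [Set.indicator_of_mem (by exact hp)]
          simp only [Cond_eq]
          rw [ ← integral_indicator_one hA]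
          congr 1 with f
          by_cases h2 : f ∈ A <;> simp [Set.indicator, hp, h2]
        · rw [Set.indicator_of_notMem (by exact hp)]
          simp [hp]
      · ext p
        by_cases h1 : noisy τ x p ∈ B <;> by_cases h2 : p.1 ∈ A <;>
          simp [Set.indicator, h1, h2]
    · exact (integrable_const (1 : ℝ)).indicator (μ := joint ν)
        (s := (fun p => (p.1, noisy τ x p)) ⁻¹' (A ×ˢ B))
        ((by fun_prop : Measurable fun p : C(X, ℝ) × ℝ => (p.1, noisy τ x p)) (hA.prod hB))
  · exact (hmeas.comp (comap_measurable _)).stronglyMeasurable.aestronglyMeasurable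

end Tower

/-! ### Dependence of conditioning on the observation point. -/

section Continuity

variable {X : Type u} [MetricSpace X] [CompactSpace X] (τ : C(X, ℝ≥0))

theorem continuous_covDual (ν : GaussMeas X) : Continuous fun x => covDual ν (ev x) := by
  have hb : MemLp (fun f : C(X, ℝ) => f - meanC ν) 2 ν.1 :=
    (memLp_two_gauss ν).sub (memLp_const _)
  -- The bound is uniform in `x` because `|f x - m x| ≤ ‖f - m‖`; it is integrable since Gaussian
  -- measures have second moments.
  refine continuous_of_dominated (bound := fun f => ‖f - meanC ν‖ ^ 2)
    (fun x => (integrable_covDual ν (ev x)).aestronglyMeasurable)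
    (fun x => Eventually.of_forall fun f => ?_) (hb.integrable_norm_pow (by norm_num))
    (Eventually.of_forall fun f => ?_)
  · rw [norm_smul, sq]
    gcongr
    exact (f - meanC ν).norm_coe_le_norm x
  · simp only [ev_apply]
    fun_prop

theorem continuous_predVar (ν : GaussMeas X) : Continuous (predVar τ ν) := by
  have h : Continuous fun x => covDual ν (ev x) x := by
    have := continuous_covDual ν
    fun_prop
  simp only [covDual_ev_apply] at h
  exact h.add ((NNReal.continuous_coe.comp τ.continuous).pow 2)

theorem isOpen_predVar_pos (ν : GaussMeas X) : IsOpen {x | 0 < predVar τ ν x} :=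
  isOpen_lt continuous_const (continuous_predVar τ ν)

theorem tendsto_gain (ν : GaussMeas X) {x : X} (hx : 0 < predVar τ ν x) {s : ℕ → X}
    (hs : Tendsto s atTop (𝓝 x)) : Tendsto (fun n => gain τ ν (s n)) atTop (𝓝 (gain τ ν x)) :=
  ((((continuous_predVar τ ν).tendsto x).comp hs).inv₀ hx.ne').smul
    (((continuous_covDual ν).tendsto x).comp hs)

/-- The mean of the conditioned measure in `C(X, ℝ)`. -/
theorem coe_mean_Cond (x : X) (z : ℝ) (ν : GaussMeas X) :
    mean (Cond τ x z ν) = ⇑(meanC ν + (z - mean ν x) • gain τ ν x) := by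
  ext y
  rw [Cond_eq, mean_condLaw]
  simp [meanC_apply, mul_comm]

/-- The update of the covariance function as an element of `C(X × X, ℝ)`. -/
theorem covFun_Cond (x : X) (z : ℝ) (ν : GaussMeas X) (q : X × X) :
    covFun (Cond τ x z ν) q.1 q.2 = covFun ν q.1 q.2 -
      ((gain τ ν x).comp (ContinuousMap.fst : C(X × X, X)) *
        (covDual ν (ev x)).comp ContinuousMap.snd : C(X × X, ℝ)) q := by
  rw [Cond_eq, covFun_condLaw]
  simp [covDual_ev_apply]

/-- The sample `p` is fixed while the point and the observed value both move. Convergence holds for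
every `p`, through norm convergence in `C(X, ℝ)` and `C(X × X, ℝ)`. -/
theorem convGM_Cond (ν : GaussMeas X) {x : X} (hx : 0 < predVar τ ν x) {s : ℕ → X}
    (hs : Tendsto s atTop (𝓝 x)) (p : C(X, ℝ) × ℝ) :
    ConvGM (fun n => Cond τ (s n) (noisy τ (s n) p) ν) (Cond τ x (noisy τ x p) ν) := by
  have hg := tendsto_gain τ ν hx hs
  have hc := ((continuous_covDual ν).tendsto x).comp hs
  have hn : Continuous fun x => noisy τ x p := by
    simp only [noisy_apply]
    exact p.1.continuous.add (continuous_const.mul (NNReal.continuous_coe.comp τ.continuous))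
  have hm : Continuous fun x => mean ν x := by
    simp only [← meanC_apply]
    exact (meanC ν).continuous
  constructor
  · simp only [coe_mean_Cond]
    refine (ContinuousMap.tendsto_iff_tendstoUniformly (F := fun n =>
      meanC ν + (noisy τ (s n) p - mean ν (s n)) • gain τ ν (s n))).1 ?_
    exact tendsto_const_nhds.add (((((hn.sub hm).tendsto x).comp hs)).smul hg)
  · simp only [covFun_Cond]
    have h : Tendsto (fun n => (gain τ ν (s n)).comp (ContinuousMap.fst : C(X × X, X)) *
        (covDual ν (ev (s n))).comp ContinuousMap.snd) atTop
        (𝓝 ((gain τ ν x).comp ContinuousMap.fst *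
          (covDual ν (ev x)).comp ContinuousMap.snd)) :=
      (((ContinuousMap.continuous_precomp _).tendsto _).comp hg).mul
        (((ContinuousMap.continuous_precomp _).tendsto _).comp hc)
    have h' := ContinuousMap.tendsto_iff_tendstoUniformly.1 h
    rw [Metric.tendstoUniformly_iff] at h' ⊢
    simpa only [dist_sub_left] using h'

theorem gain_eq_zero {ν : GaussMeas X} {x : X} (hx : predVar τ ν x = 0) : gain τ ν x = 0 := by
  rw [gain, hx, inv_zero, zero_smul]

theorem Cond_eq_self {ν : GaussMeas X} {x : X} (hx : predVar τ ν x = 0) (z : ℝ) :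
    Cond τ x z ν = ν := by
  refine gaussMeas_ext (funext fun y => ?_) (funext fun y => funext fun y' => ?_)
  · rw [Cond_eq, mean_condLaw, gain_eq_zero τ hx]
    simp
  · rw [Cond_eq, covFun_condLaw, gain_eq_zero τ hx]
    simp

end Continuity

/-! ### Finiteness, continuity and maximisers of `𝒥`. -/

section Functional

variable {X : Type u} [MetricSpace X] [CompactSpace X] [MeasurableSpace X] [BorelSpace X]
  (τ : C(X, ℝ≥0)) {H H₁ : GaussMeas X → ℝ} {L₀ : C(X, ℝ) → ℝ}

theorem integrable_integral_Cond (hL₀_meas : Measurable L₀)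
    (hL₀_int : ∀ ν : GaussMeas X, Integrable L₀ ν.1) (ν : GaussMeas X) (x : X) :
    Integrable (fun p => ∫ f, L₀ f ∂(Cond τ x (noisy τ x p) ν).1) (joint ν) ∧
      ∫ p, (∫ f, L₀ f ∂(Cond τ x (noisy τ x p) ν).1) ∂(joint ν) = ∫ f, L₀ f ∂ν.1 := by
  have hi : Integrable (fun p : C(X, ℝ) × ℝ => L₀ p.1) (joint ν) := (hL₀_int ν).comp_fst _
  have h := integral_condLaw_noisy τ ν x (h := fun q => L₀ q.1)
    (hL₀_meas.comp measurable_fst).stronglyMeasurable hi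
  simp only [Cond_eq]
  refine ⟨h.1, h.2.trans ?_⟩
  conv_rhs => rw [← map_fst_joint ν]
  rw [integral_map (by fun_prop) hL₀_meas.aestronglyMeasurable]

theorem memLp_Cond (hH₁_ui : IsUIGaussCond H₁) (ν : GaussMeas X) (x : X) :
    MemLp (fun p => H₁ (Cond τ x (noisy τ x p) ν)) 1 (joint ν) := by
  have hG : IsGaussian ((joint ν).map Prod.fst) := by
    rw [map_fst_joint]
    infer_instance
  exact (hH₁_ui _ (joint ν) Prod.fst measurable_fst hG).memLp
    ⟨_, isGaussCondDistrib_Cond τ ν x⟩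

/-- By the tower property the first summand does not involve `x`. Since `L₀` and `H₁` may change
sign, the splitting is done with real integrals, and only the sum `H` returns to `ℝ≥0∞`. -/
theorem Jfun_eq (hH_nonneg : ∀ ν, 0 ≤ H ν) (hL₀_meas : Measurable L₀)
    (hL₀_int : ∀ ν : GaussMeas X, Integrable L₀ ν.1)
    (hH : ∀ ν : GaussMeas X, H ν = (∫ f, L₀ f ∂ν.1) + H₁ ν) (hH₁_ui : IsUIGaussCond H₁)
    (ν : GaussMeas X) (x : X) :
    Jfun τ H x ν = ENNReal.ofReal
      ((∫ f, L₀ f ∂ν.1) + ∫ p, H₁ (Cond τ x (noisy τ x p) ν) ∂(joint ν)) := by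
  have h0 := integrable_integral_Cond τ hL₀_meas hL₀_int ν x
  have h1 := memLp_one_iff_integrable.1 (memLp_Cond τ hH₁_ui ν x)
  have hint : Integrable (fun p => H (Cond τ x (noisy τ x p) ν)) (joint ν) := by
    simp only [hH]
    exact h0.1.add h1
  rw [← h0.2, ← integral_add h0.1 h1]
  simp only [← hH]
  rw [ofReal_integral_eq_lintegral_ofReal hint (Eventually.of_forall fun p => hH_nonneg _)]
  simp only [noisy_apply]
  rfl

/-- Vitali's theorem: the measure `joint ν` is fixed, and the integrands converge almost surely and
are uniformly integrable. -/
theorem tendsto_integral_Cond (hH₁_ui : IsUIGaussCond H₁) (hH₁_cont : IsASContGaussCond H₁)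
    (ν : GaussMeas X) {x : X} (hx : 0 < predVar τ ν x) {s : ℕ → X}
    (hs : Tendsto s atTop (𝓝 x)) :
    Tendsto (fun n => ∫ p, H₁ (Cond τ (s n) (noisy τ (s n) p) ν) ∂(joint ν)) atTop
      (𝓝 (∫ p, H₁ (Cond τ x (noisy τ x p) ν) ∂(joint ν))) := by
  have hG : IsGaussian ((joint ν).map Prod.fst) := by
    rw [map_fst_joint]
    infer_instance
  have hae := hH₁_cont _ (joint ν) Prod.fst measurable_fst hG
    (fun n p => Cond τ (s n) (noisy τ (s n) p) ν) (fun p => Cond τ x (noisy τ x p) ν)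
    (fun n => isGaussCondDistrib_Cond τ ν (s n)) (isGaussCondDistrib_Cond τ ν x)
    (Eventually.of_forall fun p => convGM_Cond τ ν hx hs p)
  have hui : UnifIntegrable (fun n p => H₁ (Cond τ (s n) (noisy τ (s n) p) ν)) 1 (joint ν) := by
    intro ε hε
    obtain ⟨δ, hδ, h⟩ := (hH₁_ui _ (joint ν) Prod.fst measurable_fst hG).unifIntegrable hε
    exact ⟨δ, hδ, fun n => h ⟨_, isGaussCondDistrib_Cond τ ν (s n)⟩⟩
  have hmem := fun y => memLp_Cond τ hH₁_ui ν y
  have hL := tendsto_Lp_finite_of_tendsto_ae le_rfl ENNReal.one_ne_top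
    (fun n => (hmem (s n)).aestronglyMeasurable) (hmem x) hui hae
  exact tendsto_integral_of_L1' _ (hmem x).aestronglyMeasurable
    (Eventually.of_forall fun n => memLp_one_iff_integrable.1 (hmem (s n))) hL

theorem continuousOn_Jfun (hH_nonneg : ∀ ν, 0 ≤ H ν) (hL₀_meas : Measurable L₀)
    (hL₀_int : ∀ ν : GaussMeas X, Integrable L₀ ν.1)
    (hH : ∀ ν : GaussMeas X, H ν = (∫ f, L₀ f ∂ν.1) + H₁ ν) (hH₁_ui : IsUIGaussCond H₁)
    (hH₁_cont : IsASContGaussCond H₁) (ν : GaussMeas X) :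
    ContinuousOn (fun x => Jfun τ H x ν) {x | 0 < predVar τ ν x} := by
  refine fun x hx => ContinuousAt.continuousWithinAt (tendsto_of_seq_tendsto fun s hs => ?_)
  simp only [Function.comp_def, Jfun_eq τ hH_nonneg hL₀_meas hL₀_int hH hH₁_ui]
  exact (ENNReal.continuous_ofReal.tendsto _).comp
    (tendsto_const_nhds.add (tendsto_integral_Cond τ hH₁_ui hH₁_cont ν hx hs))

/-- The canonical probability space of the model. -/
def canonical (ν : GaussMeas X) : Measure (C(X, ℝ) × (ℕ → ℝ)) :=
  ν.1.prod (Measure.infinitePi fun _ => gaussianReal 0 1)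

instance instIsProbabilityMeasureCanonical (ν : GaussMeas X) :
    IsProbabilityMeasure (canonical ν) := by
  unfold canonical; infer_instance

theorem isModel_canonical (ν : GaussMeas X) :
    IsModel (canonical ν) ν Prod.fst fun i ω => ω.2 i where
  meas_ξ := measurable_fst
  law_ξ := by simp [canonical]
  meas_U i := by fun_prop
  law_U i := by
    exact ((measurePreserving_eval_infinitePi (fun _ : ℕ => gaussianReal 0 1) i).comp
      measurePreserving_snd).map_eq
  indep_U := by
    rw [iIndepFun_iff_map_fun_eq_infinitePi_map (fun i => by fun_prop)]
    have h : ∀ i, (canonical ν).map (fun ω => ω.2 i) = gaussianReal 0 1 := fun i =>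
      ((measurePreserving_eval_infinitePi (fun _ : ℕ => gaussianReal 0 1) i).comp
        measurePreserving_snd).map_eq
    simp only [h]
    exact measurePreserving_snd.map_eq
  indep_ξ_U := indepFun_prod measurable_id measurable_id

theorem map_canonical (ν : GaussMeas X) (i : ℕ) :
    MeasurePreserving (fun ω => (ω.1, ω.2 i)) (canonical ν) (joint ν) :=
  (MeasurePreserving.id ν.1).prod
    (measurePreserving_eval_infinitePi (fun _ : ℕ => gaussianReal 0 1) i)

/-- The supermartingale property only starts at time 1, so the prior cannot be compared directly
with its first update. An initial observation at the uninformative `x` leaves `ν` unchanged at time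
1; observing at `y` next gives the inequality between times 1 and 2. -/
theorem integral_Cond_le (hH₁_meas : Measurable H₁)
    (hH₁_super : HasSupermartingaleProperty τ H₁) {ν : GaussMeas X} {x : X}
    (hx : predVar τ ν x = 0) (y : X) :
    ∫ p, H₁ (Cond τ y (noisy τ y p) ν) ∂(joint ν) ≤ H₁ ν := by
  set D : ℕ → C(X, ℝ) × (ℕ → ℝ) → X := fun n _ => if n = 0 then x else y with hDdef
  set U : ℕ → C(X, ℝ) × (ℕ → ℝ) → ℝ := fun i ω => ω.2 i with hU
  have hD : IsSequentialDesign τ Prod.fst U D := fun n => measurable_const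
  have hs := hH₁_super _ (canonical ν) ν Prod.fst U D (isModel_canonical ν) hD
  have h1 : ∀ ω, posterior τ ν Prod.fst U D 1 ω = ν := fun ω => Cond_eq_self τ hx _
  have h2 : ∀ ω, posterior τ ν Prod.fst U D 2 ω =
      Cond τ y (noisy τ y (ω.1, ω.2 1)) ν := fun ω => by
    rw [posterior, h1, obs, noisy_apply, mul_comm (ω.2 1)]
    rfl
  -- Indices 0 and 1 of the shifted filtration are times 1 and 2.
  have hle := hs.setIntegral_le (Nat.zero_le 1) (s := Set.univ) MeasurableSet.univ
  simp only [Measure.restrict_univ, zero_add, Nat.reduceAdd, h1, h2, integral_const,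
    probReal_univ, one_smul] at hle
  refine le_trans (le_of_eq ?_) hle
  rw [← (map_canonical ν 1).map_eq, integral_map (by fun_prop)]
  exact (hH₁_meas.comp ((measurable_Cond_left τ ν y).comp
    (noisy τ y).continuous.measurable)).aestronglyMeasurable

theorem Jfun_le_of_predVar_eq_zero (hH_nonneg : ∀ ν, 0 ≤ H ν) (hL₀_meas : Measurable L₀)
    (hL₀_int : ∀ ν : GaussMeas X, Integrable L₀ ν.1)
    (hH : ∀ ν : GaussMeas X, H ν = (∫ f, L₀ f ∂ν.1) + H₁ ν) (hH₁_meas : Measurable H₁)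
    (hH₁_ui : IsUIGaussCond H₁) (hH₁_super : HasSupermartingaleProperty τ H₁) {ν : GaussMeas X}
    {x : X} (hx : predVar τ ν x = 0) (y : X) : Jfun τ H y ν ≤ Jfun τ H x ν := by
  rw [Jfun_eq τ hH_nonneg hL₀_meas hL₀_int hH hH₁_ui, Jfun_eq τ hH_nonneg hL₀_meas hL₀_int hH hH₁_ui]
  refine ENNReal.ofReal_le_ofReal (add_le_add_right ?_ _)
  refine (integral_Cond_le τ hH₁_meas hH₁_super hx y).trans (le_of_eq ?_)
  simp [Cond_eq_self τ hx]

end Functional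

/-! ### Measurable choice of a nearly optimal point. -/

section Selection

variable {X : Type u} [MetricSpace X] [CompactSpace X] [MeasurableSpace X] [BorelSpace X]
  (τ : C(X, ℝ≥0)) {H : GaussMeas X → ℝ}

/-- At points of positive predictive variance, continuity lets the dense sequence come close to the
value. At the others the value is maximal, so any term of the sequence does. -/
theorem iInf_denseSeq_le [Nonempty X] {ν : GaussMeas X}
    (hc : ContinuousOn (fun x => Jfun τ H x ν) {x | 0 < predVar τ ν x})
    (hle : ∀ x, predVar τ ν x = 0 → ∀ y, Jfun τ H y ν ≤ Jfun τ H x ν) :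
    ⨅ k, Jfun τ H (TopologicalSpace.denseSeq X k) ν ≤ ⨅ x, Jfun τ H x ν := by
  refine le_iInf fun x => ?_
  rcases (predVar_nonneg τ ν x).eq_or_lt with h | h
  · exact (iInf_le _ 0).trans (hle x h.symm _)
  · refine le_of_forall_gt fun c hxc => ?_
    have hn : ∀ᶠ y in 𝓝 x, Jfun τ H y ν < c :=
      (hc.continuousAt ((isOpen_predVar_pos τ ν).mem_nhds h)).eventually_lt_const hxc
    obtain ⟨_, hy, k, rfl⟩ :=
      mem_closure_iff_nhds.1 (TopologicalSpace.denseRange_denseSeq X x) _ hn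
    exact (iInf_le _ k).trans_lt hy

theorem exists_measurable_selection [Nonempty X] (hH : Measurable H)
    (hfin : ∀ (ν : GaussMeas X) x, Jfun τ H x ν ≠ ∞)
    (hc : ∀ ν : GaussMeas X,
      ContinuousOn (fun x => Jfun τ H x ν) {x | 0 < predVar τ ν x})
    (hle : ∀ (ν : GaussMeas X) x, predVar τ ν x = 0 → ∀ y, Jfun τ H y ν ≤ Jfun τ H x ν)
    {ε : ℝ} (hε : 0 < ε) :
    ∃ s : GaussMeas X → X, Measurable s ∧
      ∀ ν, Jfun τ H (s ν) ν ≤ (⨅ x, Jfun τ H x ν) + ENNReal.ofReal ε := by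
  classical
  set d := TopologicalSpace.denseSeq X
  set p : ℕ → GaussMeas X → Prop := fun k ν =>
    Jfun τ H (d k) ν ≤ (⨅ j, Jfun τ H (d j) ν) + ENNReal.ofReal ε
  have hex : ∀ ν, ∃ k, p k ν := fun ν => by
    have hne : ⨅ j, Jfun τ H (d j) ν ≠ ∞ :=
      ((iInf_le _ 0).trans_lt (hfin ν (d 0)).lt_top).ne
    obtain ⟨k, hk⟩ := iInf_lt_iff.1
      -- Finiteness of the infimum is what makes adding `ε` a strict increase.
      (ENNReal.lt_add_right hne (ENNReal.ofReal_pos.2 hε).ne')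
    exact ⟨k, hk.le⟩
  refine ⟨fun ν => d (Nat.find (hex ν)), Measurable.find (f := fun k _ => d k)
    (fun _ => measurable_const) (fun k => measurableSet_le (measurable_Jfun τ hH _)
      ((Measurable.iInf fun j => measurable_Jfun τ hH _).add_const _)) hex, fun ν => ?_⟩
  exact (Nat.find_spec (hex ν)).trans (by gcongr; exact iInf_denseSeq_le τ (hc ν) (hle ν))

end Selection

/-! ### From a policy on posteriors to a sequential design. -/

section Design

variable {X : Type u} [MetricSpace X] [CompactSpace X] (τ : C(X, ℝ≥0)) {Ω : Type v}

/-- The posterior when the evaluation points are chosen by the policy `s`. -/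
def policyPosterior (ν₀ : GaussMeas X) (ξ : Ω → C(X, ℝ)) (U : ℕ → Ω → ℝ)
    (s : ℕ → GaussMeas X → X) : ℕ → Ω → GaussMeas X
  | 0, _ => ν₀
  | n + 1, ω =>
    Cond τ (s n (policyPosterior ν₀ ξ U s n ω))
      (obs τ ξ U (fun _ ω => s n (policyPosterior ν₀ ξ U s n ω)) n ω)
      (policyPosterior ν₀ ξ U s n ω)

/-- The design that chooses its evaluation points by the policy `s`. -/
def policyDesign (ν₀ : GaussMeas X) (ξ : Ω → C(X, ℝ)) (U : ℕ → Ω → ℝ)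
    (s : ℕ → GaussMeas X → X) (n : ℕ) (ω : Ω) : X :=
  s n (policyPosterior τ ν₀ ξ U s n ω)

theorem posterior_policyDesign (ν₀ : GaussMeas X) (ξ : Ω → C(X, ℝ)) (U : ℕ → Ω → ℝ)
    (s : ℕ → GaussMeas X → X) (n : ℕ) :
    posterior τ ν₀ ξ U (policyDesign τ ν₀ ξ U s) n = policyPosterior τ ν₀ ξ U s n := by
  induction n with
  | zero => rfl
  | succ n ih =>
    ext1 ω
    rw [posterior, policyPosterior, ih]
    rfl

variable [MeasurableSpace Ω] [MeasurableSpace X] [BorelSpace X]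

theorem isSequentialDesign_policyDesign (ν₀ : GaussMeas X) (ξ : Ω → C(X, ℝ)) (U : ℕ → Ω → ℝ)
    {s : ℕ → GaussMeas X → X} (hs : ∀ n, Measurable (s n)) :
    IsSequentialDesign τ ξ U (policyDesign τ ν₀ ξ U s) := by
  set D := policyDesign τ ν₀ ξ U s
  -- The induction runs on the posterior, since the next point is a measurable function of it.
  suffices h : ∀ n, Measurable[history τ ξ U D n] (policyPosterior τ ν₀ ξ U s n) from
    fun n => (hs n).comp (h n)
  intro n
  induction n with
  | zero => exact measurable_const
  | succ n ih =>
    have hQ : Measurable[history τ ξ U D (n + 1)] (policyPosterior τ ν₀ ξ U s n) :=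
      ih.mono (history_mono τ ξ U D n.le_succ) le_rfl
    have hZ : Measurable[history τ ξ U D (n + 1)] (obs τ ξ U D n) :=
      Measurable.mono (comap_measurable _)
        (le_sup_right.trans (le_iSup₂_of_le n n.lt_succ_self le_rfl)) le_rfl
    exact (measurable_Cond τ).comp ((((hs n).comp hQ).prodMk hZ).prodMk hQ)

end Design

end SUR

end

theorem mainTheorem2 {X : Type u} [MetricSpace X] [CompactSpace X] [Nonempty X]
    [MeasurableSpace X] [BorelSpace X] (τ : C(X, ℝ≥0))
    (H H₁ : SUR.GaussMeas X → ℝ) (L₀ : C(X, ℝ) → ℝ)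
    (hH_meas : Measurable H) (hH_nonneg : ∀ ν, 0 ≤ H ν)
    (hL₀_meas : Measurable L₀) (hL₀_int : ∀ ν : SUR.GaussMeas X, Integrable L₀ ν.1)
    (hH : ∀ ν : SUR.GaussMeas X, H ν = (∫ f, L₀ f ∂ν.1) + H₁ ν)
    (hH₁_meas : Measurable H₁)
    (hH₁_ui : SUR.IsUIGaussCond H₁)
    (hH₁_cont : SUR.IsASContGaussCond H₁)
    (hH₁_super : SUR.HasSupermartingaleProperty τ H₁)
    {Ω : Type v} [MeasurableSpace Ω] (P : Measure Ω) [IsProbabilityMeasure P]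
    (ν₀ : SUR.GaussMeas X) (ξ : Ω → C(X, ℝ)) (U : ℕ → Ω → ℝ)
    (hM : SUR.IsModel P ν₀ ξ U) :
    (∀ D : ℕ → Ω → X, SUR.IsSequentialDesign τ ξ U D → ∀ (n : ℕ) (ω : Ω),
      (∀ x, SUR.Jfun τ H x (SUR.posterior τ ν₀ ξ U D n ω) ≠ ∞) ∧
      ContinuousOn (fun x => SUR.Jfun τ H x (SUR.posterior τ ν₀ ξ U D n ω))
        {x | 0 < SUR.predVar τ (SUR.posterior τ ν₀ ξ U D n ω) x}) ∧
    (∀ ε : ℕ → ℝ, (∀ n, 0 < ε n) →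
      ∃ D : ℕ → Ω → X, SUR.IsQuasiSUR τ H ν₀ ξ U ε D) := by
  have hfin : ∀ (ν : SUR.GaussMeas X) x, SUR.Jfun τ H x ν ≠ ∞ := fun ν x => by
    rw [SUR.Jfun_eq τ hH_nonneg hL₀_meas hL₀_int hH hH₁_ui]
    exact ENNReal.ofReal_ne_top
  have hc := SUR.continuousOn_Jfun τ hH_nonneg hL₀_meas hL₀_int hH hH₁_ui hH₁_cont
  refine ⟨fun D _ n ω => ⟨hfin _, hc _⟩, fun ε hε => ?_⟩
  choose s hs hsJ using fun n => SUR.exists_measurable_selection τ hH_meas hfin hc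
    (fun ν x hx => SUR.Jfun_le_of_predVar_eq_zero τ hH_nonneg hL₀_meas hL₀_int hH hH₁_meas
      hH₁_ui hH₁_super hx) (hε n)
  -- The policy `s n` is `ε n`-optimal at every posterior, so `n₀ = 0` works.
  refine ⟨SUR.policyDesign τ ν₀ ξ U s,
    SUR.isSequentialDesign_policyDesign τ ν₀ ξ U hs, 0, fun n _ ω => ?_⟩
  rw [SUR.posterior_policyDesign]
  exact hsJ n _
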